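/- Let $n\ge 1$ and let $A_n$ be the surface area of the unit sphere in $\mathbb R^n$. Let $f$ be a measurable, nonnegative function on $(0,\infty)$ with $$0<M_n^f:=A_n\int_0^\infty f(r)\,r^{n-1}\,dr<\infty ,$$ and let $\mu_n^f$ be the radial probability measure on $\mathbb R^n$ with Lebesgue density $x\mapsto f(|x|)/M_n^f$. For a function $\rho$ on $(0,\infty)$ set $s_n^\rho(x)=\rho(|x|)x$ for $x\in\mathbb R^n\setminus\{0\}$ and $s_n^\rho(0)=0$. Say that $\rho$ satisfies (C) if $\rho$ is $C^1$ and positive on $(0,\infty)$ and $s_1^\rho$ is strictly increasing on $\mathbb R$ with positive derivative on $(0,\infty)$. For such $\rho$, with $\sigma$ the inverse function of $s_1^\rho$, let $\nu_n^\rho$ be the measure on $\mathbb R^n$ whose Lebesgue density is $$f_n^\rho(x)=(2\pi)^{-n/2}\exp\Bigl(-\frac{\sigma(|x|)^2}{2}\Bigr)\Bigl\{\frac{\sigma(|x|)}{|x|}\Bigr\}^{n-1}\sigma'(|x|)\quad\text{if }x\in s_n^\rho(\mathbb R^n\setminus\{0\}),\qquad f_n^\rho(x)=0\quad\text{otherwise.}$$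 The measure $\mu_n^f$ is called a generalized Poincaré limit if $\mu_n^f=\nu_n^\rho$ for some $\rho$ satisfying (C). The density $f$ is considered up to Lebesgue-null sets; accordingly, $\operatorname{supp}(f)\subset\mathbb R$ is its essential support, the set of all $r\in\mathbb R$ such that $\{t\in U: t>0,\ f(t)\neq 0\}$ has positive Lebesgue measure for every neighbourhood $U$ of $r$. Then $\mu_n^f$ is a generalized Poincaré limit if and only if $\operatorname{supp}(f)$ is connected and, on the interior of $\operatorname{supp}(f)$, $f$ agrees almost everywhere with a continuous and positive function. Moreover, whenever $\mu_n^f=\nu_n^\rho$ with $\rho$ satisfying (C), $\operatorname{supp}(f)$ is the closure in $\mathbb R$ of $s_1^\rho((0,\infty))$. -/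

import Mathlib

open MeasureTheory Set

noncomputable section

namespace GenPoincare

/-- The map `s_n^ρ`: `x ↦ ρ(|x|) x` for `x ≠ 0`, and `0 ↦ 0`. It is used on `ℝⁿ` and, for `n = 1`,
directly on `ℝ`. -/
def radialMap {E : Type*} [NormedAddCommGroup E] [NormedSpace ℝ E] (ρ : ℝ → ℝ) (x : E) : E :=
  open Classical in if x = 0 then 0 else ρ ‖x‖ • x

/-- Condition (C) on a function `ρ` on `(0, ∞)`; the values of `ρ` outside `(0, ∞)` play no role.
The last field says that the `C¹` map `s_1^ρ` has no critical point on `(0, ∞)`, equivalently that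
its inverse `σ`, whose derivative enters the density of `ν_n^ρ`, is differentiable. -/
structure ConditionC (ρ : ℝ → ℝ) : Prop where
  contDiffOn : ContDiffOn ℝ 1 ρ (Ioi 0)
  pos : ∀ r, 0 < r → 0 < ρ r
  strictMono : StrictMono (radialMap ρ : ℝ → ℝ)
  deriv_pos : ∀ r, 0 < r → 0 < deriv (radialMap ρ : ℝ → ℝ) r

/-- The inverse function `σ` of `s_1^ρ : ℝ → ℝ` (an arbitrary value outside the range). -/
def sigma (ρ : ℝ → ℝ) : ℝ → ℝ := Function.invFun (radialMap ρ : ℝ → ℝ)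

/-- The density `f_n^ρ` on `ℝⁿ`. -/
def limitDensity (n : ℕ) (ρ : ℝ → ℝ) (x : EuclideanSpace ℝ (Fin n)) : ℝ :=
  open Classical in
  if x ∈ radialMap ρ '' ({0}ᶜ : Set (EuclideanSpace ℝ (Fin n))) then
    (2 * Real.pi) ^ (-(n : ℝ) / 2) * Real.exp (-(sigma ρ ‖x‖) ^ 2 / 2)
      * (sigma ρ ‖x‖ / ‖x‖) ^ (n - 1) * deriv (sigma ρ) ‖x‖
  else 0

/-- The measure `ν_n^ρ` on `ℝⁿ` with Lebesgue density `f_n^ρ`. -/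
def limitMeasure (n : ℕ) (ρ : ℝ → ℝ) : Measure (EuclideanSpace ℝ (Fin n)) :=
  volume.withDensity fun x => ENNReal.ofReal (limitDensity n ρ x)

/-- `A_n`, the surface area of the unit sphere in `ℝⁿ`. -/
def sphereArea (n : ℕ) : ℝ :=
  (volume : Measure (EuclideanSpace ℝ (Fin n))).toSphere.real univ

/-- The normalizing constant `M_n^f = A_n ∫₀^∞ f(r) r^{n-1} dr`. -/
def radialMass (n : ℕ) (f : ℝ → ℝ) : ℝ :=
  sphereArea n * ∫ r in Ioi (0 : ℝ), f r * r ^ (n - 1)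

/-- `f` is a measurable, nonnegative function on `(0, ∞)` which can be normalized to a radial
probability density on `ℝⁿ`, i.e. with `0 < M_n^f < ∞`; the values of `f` outside `(0, ∞)` play
no role. -/
structure IsRadialDensity (n : ℕ) (f : ℝ → ℝ) : Prop where
  measurable : Measurable fun r : Ioi (0 : ℝ) => f r
  nonneg : ∀ r, 0 < r → 0 ≤ f r
  integrableOn : IntegrableOn (fun r => f r * r ^ (n - 1)) (Ioi 0)
  mass_pos : 0 < radialMass n f

/-- The radial probability measure `μ_n^f` on `ℝⁿ`, with Lebesgue density `f(|x|) / M_n^f`. -/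
def radialMeasure (n : ℕ) (f : ℝ → ℝ) : Measure (EuclideanSpace ℝ (Fin n)) :=
  volume.withDensity fun x => ENNReal.ofReal (f ‖x‖ / radialMass n f)

/-- `μ_n^f` is a generalized Poincaré limit. -/
def IsGeneralizedPoincareLimit (n : ℕ) (f : ℝ → ℝ) : Prop :=
  ∃ ρ : ℝ → ℝ, ConditionC ρ ∧ radialMeasure n f = limitMeasure n ρ

/-- The (essential) support in `ℝ` of a nonnegative density `f` on `(0, ∞)`: the points every
neighbourhood of which meets `{r > 0 | f r ≠ 0}` in a set of positive Lebesgue measure. -/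
def densitySupport (f : ℝ → ℝ) : Set ℝ :=
  {r | ∀ U ∈ nhds r, 0 < volume (U ∩ {t | 0 < t ∧ f t ≠ 0})}

/-- Up to a Lebesgue null set, `f` is continuous and positive on the set `s`. -/
def HasContinuousPosVersionOn (f : ℝ → ℝ) (s : Set ℝ) : Prop :=
  ∃ g : ℝ → ℝ, ContinuousOn g s ∧ (∀ r ∈ s, 0 < g r) ∧ f =ᵐ[volume.restrict s] g

end GenPoincare

end

/-! In polar coordinates, both measures are determined by their radial densities, so μ_n^f = ν_n^ρ
says that f = M · `limitProfile n ρ` a.e. on (0, ∞), where M = M_n^f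
(`radialMeasure_eq_limitMeasure_iff`). The profile is continuous and positive on the open interval
s_1^ρ((0, ∞)) and zero off it, which gives the necessity and the formula for the support.

Conversely, ν_n^ρ is the image of the standard Gaussian under s_n^ρ, so s = s_1^ρ has to carry the
law of the Gaussian norm, with density p, to the law of |x| under μ_n^f, with density q. The
increasing transport on the line does this: s = F⁻¹ ∘ G, with F and G the distribution functions of
q and p. Since F' = q > 0 on the interior of supp f, s' = p / (q ∘ s) is continuous and positive
(`exists_transport`). Hence ρ(r) = s(r)/r satisfies (C), and the formula for s' is exactly f = M ·
profile. -/

noncomputable section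

namespace GenPoincare

open Filter Topology

/-! ### Inverse functions on an open interval -/

section Inverse

variable {U : Set ℝ} {F F' ψ : ℝ → ℝ}

lemma strictMonoOn_of_hasDerivAt_pos (hU : IsOpen U) (hc : U.OrdConnected)
    (hF : ∀ t ∈ U, HasDerivAt F (F' t) t) (hpos : ∀ t ∈ U, 0 < F' t) : StrictMonoOn F U :=
  strictMonoOn_of_deriv_pos hc.convex (fun t ht => (hF t ht).continuousAt.continuousWithinAt)
    fun t ht => by
      rw [hU.interior_eq] at ht
      rw [(hF t ht).deriv]
      exact hpos t ht

lemma isOpen_image_of_hasDerivAt_pos (hU : IsOpen U) (hc : U.OrdConnected)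
    (hF : ∀ t ∈ U, HasDerivAt F (F' t) t) (hpos : ∀ t ∈ U, 0 < F' t) : IsOpen (F '' U) := by
  have hmono := strictMonoOn_of_hasDerivAt_pos hU hc hF hpos
  have hcont : ContinuousOn F U := fun t ht => (hF t ht).continuousAt.continuousWithinAt
  rw [isOpen_iff_mem_nhds]
  rintro _ ⟨t, ht, rfl⟩
  obtain ⟨a, b, hab, hsub⟩ := mem_nhds_iff_exists_Ioo_subset.1 (hU.mem_nhds ht)
  obtain ⟨a', ha'⟩ := exists_between hab.1
  obtain ⟨b', hb'⟩ := exists_between hab.2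
  have haU : a' ∈ U := hsub ⟨ha'.1, ha'.2.trans hab.2⟩
  have hbU : b' ∈ U := hsub ⟨hab.1.trans hb'.1, hb'.2⟩
  refine mem_of_superset (Ioo_mem_nhds (hmono haU ht ha'.2) (hmono ht hbU hb'.1)) ?_
  refine (intermediate_value_Ioo (ha'.2.trans hb'.1).le (hcont.mono (hc.out haU hbU))).trans ?_
  exact image_mono fun x hx => hc.out haU hbU ⟨hx.1.le, hx.2.le⟩

/-- A left inverse of a function with positive derivative on an open interval is differentiable on
the image of this interval. -/
lemma hasDerivAt_leftInverse (hU : IsOpen U) (hc : U.OrdConnected)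
    (hF : ∀ t ∈ U, HasDerivAt F (F' t) t) (hpos : ∀ t ∈ U, 0 < F' t)
    (hψ : ∀ t ∈ U, ψ (F t) = t) {t : ℝ} (ht : t ∈ U) : HasDerivAt ψ (F' t)⁻¹ (F t) := by
  have hmono := strictMonoOn_of_hasDerivAt_pos hU hc hF hpos
  have hV := isOpen_image_of_hasDerivAt_pos hU hc hF hpos
  have hnhds : F '' U ∈ 𝓝 (F t) := hV.mem_nhds (mem_image_of_mem F ht)
  have hψmono : StrictMonoOn ψ (F '' U) := by
    rintro _ ⟨x, hx, rfl⟩ _ ⟨y, hy, rfl⟩ hxy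
    rw [hψ x hx, hψ y hy]
    exact (hmono.lt_iff_lt hx hy).1 hxy
  have himg : ψ '' (F '' U) = U := by
    rw [image_image]
    exact (image_congr hψ).trans (image_id' U)
  have hψc : ContinuousAt ψ (F t) := by
    -- A monotone function whose image of a neighbourhood is a neighbourhood of the value cannot
    -- jump.
    refine hψmono.continuousAt_of_image_mem_nhds hnhds ?_
    rw [himg, hψ t ht]
    exact hU.mem_nhds ht
  refine HasDerivAt.of_local_left_inverse (f := F) hψc ?_ (hpos t ht).ne' ?_
  · rw [hψ t ht]
    exact hF t ht
  · filter_upwards [hnhds]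
    rintro _ ⟨x, hx, rfl⟩
    rw [hψ x hx]

end Inverse

/-! ### Distribution functions -/

section DistributionFunction

variable {U : Set ℝ} {q : ℝ → ℝ}

/-- The distribution function of a probability density which is continuous and positive on an open
interval `U` and vanishes off `U` is a primitive of the density and maps `U` onto `(0, 1)`. -/
lemma exists_distributionFunction (hU : IsOpen U) (hc : U.OrdConnected) (hq : ContinuousOn q U)
    (hpos : ∀ t ∈ U, 0 < q t) (hzero : ∀ t ∉ U, q t = 0) (hint : Integrable q)
    (hone : ∫ t, q t = 1) :
    ∃ F : ℝ → ℝ, (∀ t ∈ U, HasDerivAt F (q t) t) ∧ F '' U = Ioo 0 1 := by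
  have hnonneg : ∀ t, 0 ≤ q t := fun t => by
    by_cases h : t ∈ U
    · exact (hpos t h).le
    · exact (hzero t h).ge
  set F : ℝ → ℝ := fun t => ∫ r in Iic t, q r with hFdef
  have hFeq : ∀ t, F t = F 0 + ∫ r in (0 : ℝ)..t, q r := fun t => by
    rw [← intervalIntegral.integral_Iic_sub_Iic hint.integrableOn hint.integrableOn]
    simp only [hFdef]
    ring
  have hFeq' : F = fun t => F 0 + ∫ r in (0 : ℝ)..t, q r := funext hFeq
  have hFd : ∀ t ∈ U, HasDerivAt F (q t) t := fun t ht => by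
    rw [hFeq']
    exact (intervalIntegral.integral_hasDerivAt_right hint.intervalIntegrable
      hint.aestronglyMeasurable.stronglyMeasurableAtFilter
      (hq.continuousAt (hU.mem_nhds ht))).const_add _
  have hFc : Continuous F := by
    rw [hFeq']
    exact continuous_const.add (intervalIntegral.continuous_primitive
      (fun a b => hint.intervalIntegrable) 0)
  have hF0 : ∀ t, 0 ≤ F t := fun t => integral_nonneg hnonneg
  have hF1 : ∀ t, F t ≤ 1 := fun t => by
    rw [← hone]
    exact setIntegral_le_integral hint (Eventually.of_forall hnonneg)
  have hmono := strictMonoOn_of_hasDerivAt_pos hU hc hFd hpos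
  have hbot : Tendsto F atBot (𝓝 0) := tendsto_integral_Iic_zero tendsto_id
  have htop : Tendsto F atTop (𝓝 1) := by
    rw [← hone]
    exact (aecover_Iic tendsto_id).integral_tendsto_of_countably_generated hint
  refine ⟨F, hFd, subset_antisymm ?_ ?_⟩
  · rintro _ ⟨t, ht, rfl⟩
    -- The values 0 and 1 are excluded because the open set U contains points on both sides of t,
    -- where F is strictly smaller and strictly larger.
    obtain ⟨a, b, hab, hsub⟩ := mem_nhds_iff_exists_Ioo_subset.1 (hU.mem_nhds ht)
    obtain ⟨a', ha'⟩ := exists_between hab.1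
    obtain ⟨b', hb'⟩ := exists_between hab.2
    have haU : a' ∈ U := hsub ⟨ha'.1, ha'.2.trans hab.2⟩
    have hbU : b' ∈ U := hsub ⟨hab.1.trans hb'.1, hb'.2⟩
    exact ⟨(hF0 a').trans_lt (hmono haU ht ha'.2), (hmono ht hbU hb'.1).trans_le (hF1 b')⟩
  · intro y hy
    obtain ⟨x₁, hx₁⟩ := (hbot.eventually (gt_mem_nhds hy.1)).exists
    obtain ⟨x₂, hx₂⟩ := (htop.eventually (lt_mem_nhds hy.2)).exists
    obtain ⟨t, rfl⟩ := mem_range_of_exists_le_of_exists_ge hFc ⟨x₁, hx₁.le⟩ ⟨x₂, hx₂.le⟩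
    refine ⟨t, ?_, rfl⟩
    -- A point off the interval U has U entirely on one side, so F is 1 or 0 there.
    by_contra htU
    by_cases hleft : ∃ u ∈ U, u < t
    · obtain ⟨u, hu, hut⟩ := hleft
      have hright : ∀ v ∈ (Iic t)ᶜ, q v = 0 := fun v hv => hzero v fun hvU =>
        htU (hc.out hu hvU ⟨hut.le, (notMem_Iic.1 hv).le⟩)
      have : F t = 1 := by
        rw [← hone]
        exact setIntegral_eq_integral_of_forall_compl_eq_zero hright
      exact hy.2.ne this
    · push Not at hleft
      have : F t = 0 := by
        refine setIntegral_eq_zero_of_forall_eq_zero fun v hv => hzero v fun hvU => ?_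
        have : v = t := le_antisymm hv (hleft v hvU)
        exact htU (this ▸ hvU)
      exact hy.1.ne' this

end DistributionFunction

/-! ### Null sets in polar coordinates -/

section PolarCoordinates

variable {E : Type*} [NormedAddCommGroup E] [NormedSpace ℝ E] [FiniteDimensional ℝ E]
  [MeasurableSpace E] [BorelSpace E] [Nontrivial E]

/-- A set of radii is negligible if and only if the corresponding radial set is. -/
lemma ae_norm_iff (μ : Measure E) [μ.IsAddHaarMeasure] {p : ℝ → Prop} :
    (∀ᵐ x ∂μ, p ‖x‖) ↔ ∀ᵐ r ∂volume.restrict (Ioi (0 : ℝ)), p r := by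
  have hmeas : Measurable fun r : Ioi (0 : ℝ) =>
      ENNReal.ofReal (r.1 ^ (Module.finrank ℝ E - 1)) := by fun_prop
  set N : Set (Ioi (0 : ℝ)) := {r | ¬ p r} with hN
  have h1 : (∀ᵐ x ∂μ, p ‖x‖) ↔
      (μ.comap ((↑) : ({(0 : E)}ᶜ : Set E) → E)) (homeomorphUnitSphereProd E ⁻¹' (univ ×ˢ N)) = 0 := by
    rw [comap_subtype_coe_apply (measurableSet_singleton _).compl, ae_iff]
    have : (((↑) : ({(0 : E)}ᶜ : Set E) → E) '' (homeomorphUnitSphereProd E ⁻¹' (univ ×ˢ N)))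
        = {x | ¬ p ‖x‖} \ {0} := by
      ext x
      simp [hN, and_comm]
    rw [this, measure_sdiff_null (measure_singleton _)]
  have h2 : (∀ᵐ r ∂volume.restrict (Ioi (0 : ℝ)), p r) ↔
      (volume.comap ((↑) : Ioi (0 : ℝ) → ℝ)) N = 0 := by
    rw [comap_subtype_coe_apply measurableSet_Ioi, ae_restrict_iff' measurableSet_Ioi, ae_iff]
    have : (((↑) : Ioi (0 : ℝ) → ℝ) '' N) = {r | ¬ (r ∈ Ioi 0 → p r)} := by
      ext r
      simp [hN, and_comm]
    rw [this]
  -- N need not be measurable: the embedding and product formulas hold for arbitrary sets.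
  rw [h1, h2, μ.measurePreserving_homeomorphUnitSphereProd.measure_preimage_emb
    (Homeomorph.measurableEmbedding _), Measure.prod_prod, mul_eq_zero]
  have h3 : μ.toSphere univ ≠ 0 := by
    rw [Ne, Measure.measure_univ_eq_zero]
    exact μ.toSphere_ne_zero
  rw [or_iff_right h3]
  constructor
  · intro h
    -- The density r^(d-1), d the dimension, is positive on (0, ∞), so the weighted and unweighted
    -- null sets coincide.
    refine withDensity_absolutelyContinuous' hmeas.aemeasurable (Eventually.of_forall fun r => ?_) h
    exact (ENNReal.ofReal_pos.2 (pow_pos r.2 _)).ne'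
  · intro h
    exact withDensity_absolutelyContinuous _ _ h

end PolarCoordinates

/-- Provides a globally measurable representative of a function whose measurability is known only on
s. -/
lemma measurable_indicator_of_subtype {α β : Type*} [MeasurableSpace α] [MeasurableSpace β] [Zero β]
    {s : Set α} (hs : MeasurableSet s) {f : α → β} (hf : Measurable fun x : s => f x) :
    Measurable (s.indicator f) := by
  refine measurable_of_restrict_of_restrict_compl hs ?_ ?_
  · convert hf using 1
    ext x
    exact indicator_of_mem x.2 f
  · convert measurable_const (a := (0 : β)) using 1
    ext x
    exact indicator_of_notMem x.2 f

lemma radialMap_of_pos (ρ : ℝ → ℝ) {r : ℝ} (hr : 0 < r) : radialMap ρ r = ρ r * r := by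
  simp [radialMap, hr.ne', abs_of_pos hr]

lemma radialMap_neg {E : Type*} [NormedAddCommGroup E] [NormedSpace ℝ E] (ρ : ℝ → ℝ) (x : E) :
    radialMap ρ (-x) = -radialMap ρ x := by
  by_cases hx : x = 0 <;> simp [radialMap, hx]

/-! ### Consequences of condition (C) -/

section ConditionC

variable {ρ : ℝ → ℝ}

lemma ConditionC.radialMap_pos (h : ConditionC ρ) {r : ℝ} (hr : 0 < r) :
    0 < (radialMap ρ : ℝ → ℝ) r := by
  rw [radialMap_of_pos ρ hr]
  exact mul_pos (h.pos r hr) hr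

lemma ConditionC.hasDerivAt (h : ConditionC ρ) {r : ℝ} (hr : r ∈ Ioi (0 : ℝ)) :
    HasDerivAt (radialMap ρ : ℝ → ℝ) (deriv (radialMap ρ : ℝ → ℝ) r) r :=
  (differentiableAt_of_deriv_ne_zero (h.deriv_pos r hr).ne').hasDerivAt

lemma ConditionC.continuousOn_deriv (h : ConditionC ρ) :
    ContinuousOn (deriv (radialMap ρ : ℝ → ℝ)) (Ioi 0) := by
  have : ContDiffOn ℝ 1 (radialMap ρ : ℝ → ℝ) (Ioi 0) :=
    (h.contDiffOn.mul contDiffOn_id).congr fun r hr => radialMap_of_pos ρ hr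
  exact this.continuousOn_deriv_of_isOpen isOpen_Ioi le_rfl

lemma ConditionC.sigma_radialMap (h : ConditionC ρ) (r : ℝ) :
    sigma ρ (radialMap ρ r) = r :=
  Function.leftInverse_invFun h.strictMono.injective r

lemma ConditionC.hasDerivAt_sigma (h : ConditionC ρ) {r : ℝ} (hr : 0 < r) :
    HasDerivAt (sigma ρ) (deriv (radialMap ρ : ℝ → ℝ) r)⁻¹ (radialMap ρ r) :=
  hasDerivAt_leftInverse isOpen_Ioi ordConnected_Ioi (fun _ ht => h.hasDerivAt ht)
    (fun t ht => h.deriv_pos t ht) (fun t _ => h.sigma_radialMap t) hr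

lemma ConditionC.isOpen_image (h : ConditionC ρ) :
    IsOpen ((radialMap ρ : ℝ → ℝ) '' Ioi 0) :=
  isOpen_image_of_hasDerivAt_pos isOpen_Ioi ordConnected_Ioi (fun _ ht => h.hasDerivAt ht)
    fun t ht => h.deriv_pos t ht

lemma ConditionC.ordConnected_image (h : ConditionC ρ) :
    ((radialMap ρ : ℝ → ℝ) '' Ioi 0).OrdConnected :=
  (isPreconnected_Ioi.image _ fun _ ht =>
    (h.hasDerivAt ht).continuousAt.continuousWithinAt).ordConnected

end ConditionC

/-- The radial profile of the density `f_n^ρ`. -/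
def limitProfile (n : ℕ) (ρ : ℝ → ℝ) : ℝ → ℝ :=
  ((radialMap ρ : ℝ → ℝ) '' Ioi 0).indicator fun t =>
    (2 * Real.pi) ^ (-(n : ℝ) / 2) * Real.exp (-(sigma ρ t) ^ 2 / 2)
      * (sigma ρ t / t) ^ (n - 1) * deriv (sigma ρ) t

/-! ### The radial profile of ν_n^ρ -/

section Profile

variable {n : ℕ} {ρ : ℝ → ℝ}

lemma mem_image_radialMap_iff {E : Type*} [NormedAddCommGroup E] [NormedSpace ℝ E]
    (h : ConditionC ρ) (x : E) :
    x ∈ radialMap ρ '' ({0}ᶜ : Set E) ↔ ‖x‖ ∈ (radialMap ρ : ℝ → ℝ) '' Ioi 0 := by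
  constructor
  · rintro ⟨y, hy, rfl⟩
    have hy : y ≠ 0 := hy
    have hy' : 0 < ‖y‖ := norm_pos_iff.2 hy
    refine ⟨‖y‖, hy', ?_⟩
    rw [radialMap_of_pos ρ hy', radialMap, if_neg hy, norm_smul,
      Real.norm_of_nonneg (h.pos _ hy').le]
  · rintro ⟨r, hr, hrx⟩
    have hr : 0 < r := hr
    have hx : 0 < ‖x‖ := hrx ▸ h.radialMap_pos hr
    have hn : ‖(r / ‖x‖) • x‖ = r := by
      rw [norm_smul, Real.norm_of_nonneg (by positivity), div_mul_cancel₀ _ hx.ne']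
    have hne : (r / ‖x‖) • x ≠ 0 := by
      rw [← norm_pos_iff, hn]
      exact hr
    refine ⟨(r / ‖x‖) • x, hne, ?_⟩
    rw [radialMap, if_neg hne, hn, smul_smul, ← mul_div_assoc, ← radialMap_of_pos ρ hr, hrx,
      div_self hx.ne', one_smul]

lemma limitDensity_eq_limitProfile (h : ConditionC ρ) (x : EuclideanSpace ℝ (Fin n)) :
    limitDensity n ρ x = limitProfile n ρ ‖x‖ := by
  have hiff := mem_image_radialMap_iff h x
  by_cases hx : ‖x‖ ∈ (radialMap ρ : ℝ → ℝ) '' Ioi 0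
  · rw [limitDensity, limitProfile, if_pos (hiff.2 hx), indicator_of_mem hx]
  · rw [limitDensity, limitProfile, if_neg (mt hiff.1 hx), indicator_of_notMem hx]

/-- The parametrization t = s_1^ρ(r) eliminates σ, since σ(t) = r and σ'(t) = 1/(s_1^ρ)'(r). -/
lemma limitProfile_radialMap (h : ConditionC ρ) {r : ℝ} (hr : 0 < r) :
    limitProfile n ρ (radialMap ρ r) = (2 * Real.pi) ^ (-(n : ℝ) / 2) * Real.exp (-r ^ 2 / 2)
      * (r / radialMap ρ r) ^ (n - 1) * (deriv (radialMap ρ : ℝ → ℝ) r)⁻¹ := by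
  rw [limitProfile, indicator_of_mem (mem_image_of_mem _ (mem_Ioi.2 hr)), h.sigma_radialMap,
    (h.hasDerivAt_sigma hr).deriv]

lemma limitProfile_pos (h : ConditionC ρ) {t : ℝ} (ht : t ∈ (radialMap ρ : ℝ → ℝ) '' Ioi 0) :
    0 < limitProfile n ρ t := by
  obtain ⟨r, hr, rfl⟩ := ht
  have hr : 0 < r := hr
  rw [limitProfile_radialMap h hr]
  have h1 := h.radialMap_pos hr
  have h2 := h.deriv_pos r hr
  positivity

lemma limitProfile_nonneg (h : ConditionC ρ) (t : ℝ) : 0 ≤ limitProfile n ρ t := by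
  by_cases ht : t ∈ (radialMap ρ : ℝ → ℝ) '' Ioi 0
  · exact (limitProfile_pos h ht).le
  · rw [limitProfile, indicator_of_notMem ht]

lemma continuousOn_limitProfile (h : ConditionC ρ) :
    ContinuousOn (limitProfile n ρ) ((radialMap ρ : ℝ → ℝ) '' Ioi 0) := by
  have hσ : ContinuousOn (sigma ρ) ((radialMap ρ : ℝ → ℝ) '' Ioi 0) := by
    rintro _ ⟨r, hr, rfl⟩
    exact (h.hasDerivAt_sigma hr).continuousAt.continuousWithinAt
  have hσ' : ContinuousOn (deriv (sigma ρ)) ((radialMap ρ : ℝ → ℝ) '' Ioi 0) := by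
    have hmaps : MapsTo (sigma ρ) ((radialMap ρ : ℝ → ℝ) '' Ioi 0) (Ioi 0) := by
      rintro _ ⟨r, hr, rfl⟩
      rwa [h.sigma_radialMap]
    refine ((h.continuousOn_deriv.comp hσ hmaps).inv₀ fun t ht =>
      (h.deriv_pos _ (hmaps ht)).ne').congr ?_
    rintro _ ⟨r, hr, rfl⟩
    simp [h.sigma_radialMap, (h.hasDerivAt_sigma hr).deriv]
  have hne : ∀ t ∈ (radialMap ρ : ℝ → ℝ) '' Ioi 0, t ≠ 0 := by
    rintro _ ⟨r, hr, rfl⟩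
    exact (h.radialMap_pos hr).ne'
  refine ContinuousOn.congr ?_ fun t ht => indicator_of_mem ht _
  exact ((continuousOn_const.mul (Real.continuous_exp.comp_continuousOn
    ((hσ.pow 2).neg.div_const 2))).mul ((hσ.div continuousOn_id hne).pow (n - 1))).mul hσ'

lemma measurable_limitProfile (h : ConditionC ρ) : Measurable (limitProfile n ρ) := by
  have hind : ((radialMap ρ : ℝ → ℝ) '' Ioi 0).indicator (limitProfile n ρ) = limitProfile n ρ := by
    rw [limitProfile, indicator_indicator, inter_self]
  rw [← hind]
  exact measurable_indicator_of_subtype h.isOpen_image.measurableSet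
    (continuousOn_iff_continuous_domRestrict.1 (continuousOn_limitProfile h)).measurable

end Profile

/-! ### The essential support -/

section Support

lemma isClosed_densitySupport (f : ℝ → ℝ) : IsClosed (densitySupport f) := by
  rw [← isOpen_compl_iff, isOpen_iff_mem_nhds]
  intro r hr
  simp only [densitySupport, mem_compl_iff, mem_ofPred_eq, not_forall, not_lt, nonpos_iff_eq_zero]
    at hr
  obtain ⟨U, hU, h0⟩ := hr
  filter_upwards [eventually_mem_nhds_iff.2 hU] with s hs hmem
  exact (hmem U hs).ne' h0

lemma densitySupport_subset_Ici (f : ℝ → ℝ) : densitySupport f ⊆ Ici 0 := by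
  intro r hr
  by_contra hneg
  refine (hr (Iio 0) (Iio_mem_nhds (not_le.1 hneg))).ne' ?_
  have : Iio (0 : ℝ) ∩ {t | 0 < t ∧ f t ≠ 0} = ∅ := by
    ext t
    simp only [mem_inter_iff, mem_Iio, mem_ofPred_eq, mem_empty_iff_false, iff_false]
    rintro ⟨h1, h2, -⟩
    exact h1.not_gt h2
  rw [this, measure_empty]

/-- Each point off the support has a neighbourhood in which f vanishes a.e. on (0, ∞); local nullity
implies nullity. -/
lemma ae_eq_zero_of_notMem_densitySupport (f : ℝ → ℝ) :
    ∀ᵐ t ∂volume.restrict (Ioi (0 : ℝ)), t ∉ densitySupport f → f t = 0 := by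
  rw [ae_restrict_iff' measurableSet_Ioi, ae_iff]
  refine measure_null_of_locally_null _ fun t ht => ?_
  simp only [mem_ofPred_eq, Classical.not_imp] at ht
  have h := ht.2.1
  simp only [densitySupport, mem_ofPred_eq, not_forall, not_lt, nonpos_iff_eq_zero] at h
  obtain ⟨U, hU, h0⟩ := h
  refine ⟨_, inter_mem (mem_nhdsWithin_of_mem_nhds hU) self_mem_nhdsWithin,
    measure_mono_null ?_ h0⟩
  rintro s ⟨hs, hs'⟩
  simp only [mem_ofPred_eq, Classical.not_imp] at hs'
  exact ⟨hs, hs'.1, hs'.2.2⟩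

lemma densitySupport_eq_closure {f k : ℝ → ℝ} {V : Set ℝ} (hV : IsOpen V) (hV0 : V ⊆ Ioi 0)
    (hne : ∀ t ∈ V, k t ≠ 0) (hzero : ∀ t ∉ V, k t = 0)
    (hfk : f =ᵐ[volume.restrict (Ioi (0 : ℝ))] k) : densitySupport f = closure V := by
  have hnull : volume {t | ¬ (t ∈ Ioi (0 : ℝ) → f t = k t)} = 0 :=
    ae_iff.1 ((ae_restrict_iff' measurableSet_Ioi).1 hfk)
  ext r
  constructor
  · intro hr
    by_contra hrV
    refine (hr (closure V)ᶜ (isClosed_closure.isOpen_compl.mem_nhds hrV)).ne' ?_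
    refine measure_mono_null ?_ hnull
    rintro t ⟨ht, ht0, htf⟩
    simp only [mem_ofPred_eq, Classical.not_imp]
    refine ⟨ht0, ?_⟩
    rwa [hzero t fun h => ht (subset_closure h)]
  · intro hr U hU
    obtain ⟨W, hWU, hW, hrW⟩ := mem_nhds_iff.1 hU
    have hpos : 0 < volume (W ∩ V) :=
      (hW.inter hV).measure_pos volume (mem_closure_iff.1 hr W hW hrW)
    -- Removing the null set where f and k differ keeps the measure positive.
    rw [← measure_sdiff_null hnull] at hpos
    refine hpos.trans_le (measure_mono ?_)
    rintro t ⟨⟨htW, htV⟩, ht⟩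
    simp only [mem_ofPred_eq, not_not] at ht
    exact ⟨hWU htW, hV0 htV, by rw [ht (hV0 htV)]; exact hne t htV⟩

end Support

/-! ### Reduction to radial densities -/

section Measures

variable {n : ℕ} {f ρ : ℝ → ℝ}

lemma aemeasurable_comp_norm {E : Type*} [NormedAddCommGroup E] [NormedSpace ℝ E]
    [FiniteDimensional ℝ E] [MeasurableSpace E] [BorelSpace E] [Nontrivial E]
    (μ : Measure E) [μ.IsAddHaarMeasure] (hf : Measurable fun r : Ioi (0 : ℝ) => f r) :
    AEMeasurable (fun x => f ‖x‖) μ := by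
  have hm : Measurable ((Ioi (0 : ℝ)).indicator f) :=
    measurable_indicator_of_subtype measurableSet_Ioi hf
  refine ⟨fun x => (Ioi (0 : ℝ)).indicator f ‖x‖, hm.comp measurable_norm, ?_⟩
  rw [EventuallyEq, ae_norm_iff μ (p := fun r => f r = (Ioi (0 : ℝ)).indicator f r)]
  filter_upwards [ae_restrict_mem measurableSet_Ioi] with r hr
  rw [indicator_of_mem hr]

/-- Equality of the measures `μ_n^f` and `ν_n^ρ` in terms of their radial densities. -/
lemma radialMeasure_eq_limitMeasure_iff (hn : 1 ≤ n) (hf : IsRadialDensity n f)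
    (h : ConditionC ρ) :
    radialMeasure n f = limitMeasure n ρ ↔
      f =ᵐ[volume.restrict (Ioi (0 : ℝ))] fun r => radialMass n f * limitProfile n ρ r := by
  have : Nonempty (Fin n) := ⟨⟨0, hn⟩⟩
  have hM := hf.mass_pos
  simp only [radialMeasure, limitMeasure, limitDensity_eq_limitProfile h]
  rw [withDensity_eq_iff_of_sigmaFinite
    ((aemeasurable_comp_norm volume hf.measurable).div_const _).ennreal_ofReal
    (Measurable.ennreal_ofReal
      (f := fun x => limitProfile n ρ ‖x‖) <|
        (measurable_limitProfile h).comp measurable_norm).aemeasurable,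
    EventuallyEq, ae_norm_iff volume (p := fun r =>
      ENNReal.ofReal (f r / radialMass n f) = ENNReal.ofReal (limitProfile n ρ r))]
  refine eventually_congr ?_
  filter_upwards [ae_restrict_mem measurableSet_Ioi] with r hr
  rw [ENNReal.ofReal_eq_ofReal_iff (div_nonneg (hf.nonneg r hr) hM.le) (limitProfile_nonneg h r),
    div_eq_iff hM.ne', mul_comm]

end Measures

/-- The density of the Euclidean norm of a standard Gaussian vector in `ℝⁿ`. -/
def gaussianNormDensity (n : ℕ) : ℝ → ℝ :=
  (Ioi (0 : ℝ)).indicator fun r =>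
    sphereArea n * ((2 * Real.pi) ^ (-(n : ℝ) / 2) * Real.exp (-r ^ 2 / 2) * r ^ (n - 1))

/-! ### The law of the Gaussian norm -/

section Gaussian

variable {n : ℕ}

lemma sphereArea_pos (hn : 1 ≤ n) : 0 < sphereArea n := by
  have : Nonempty (Fin n) := ⟨⟨0, hn⟩⟩
  rw [sphereArea, Measure.toSphere_real_apply_univ]
  refine mul_pos ?_ ?_
  · simpa using Nat.lt_of_lt_of_le Nat.zero_lt_one hn
  · exact ENNReal.toReal_pos (Metric.measure_ball_pos volume _ one_pos).ne' measure_ball_lt_top.ne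

/-- Polar coordinates turn this into the n-dimensional Gaussian integral, which is (2π)^(n/2). -/
lemma integral_gaussianNormDensity (hn : 1 ≤ n) : ∫ r, gaussianNormDensity n r = 1 := by
  have : Nonempty (Fin n) := ⟨⟨0, hn⟩⟩
  have h1 := integral_fun_norm_addHaar (volume : Measure (EuclideanSpace ℝ (Fin n)))
    fun r => Real.exp (-(1 / 2) * r ^ 2)
  have h2 := GaussianFourier.integral_rexp_neg_mul_sq_norm (V := EuclideanSpace ℝ (Fin n))
    (b := 1 / 2) (by norm_num)
  rw [h2] at h1
  have h3 : ∫ r, gaussianNormDensity n r = (2 * Real.pi) ^ (-(n : ℝ) / 2) *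
      (sphereArea n * ∫ r in Ioi (0 : ℝ), r ^ (n - 1) * Real.exp (-(1 / 2) * r ^ 2)) := by
    rw [gaussianNormDensity, integral_indicator measurableSet_Ioi, ← integral_const_mul,
      ← integral_const_mul]
    refine integral_congr_ae (Eventually.of_forall fun r => ?_)
    have : -(1 / 2) * r ^ 2 = -r ^ 2 / 2 := by ring
    simp only [this]
    ring
  have h4 : sphereArea n * ∫ r in Ioi (0 : ℝ), r ^ (n - 1) * Real.exp (-(1 / 2) * r ^ 2) =
      (2 * Real.pi) ^ ((n : ℝ) / 2) := by
    rw [sphereArea, Measure.toSphere_real_apply_univ, mul_assoc, ← nsmul_eq_mul, ← smul_eq_mul]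
    simp only [finrank_euclideanSpace, Fintype.card_fin, smul_eq_mul] at h1 ⊢
    rw [← h1]
    congr 1
    ring
  rw [h3, h4, ← Real.rpow_add (by positivity), neg_div, neg_add_cancel, Real.rpow_zero]

lemma gaussianNormDensity_pos (hn : 1 ≤ n) {r : ℝ} (hr : r ∈ Ioi (0 : ℝ)) :
    0 < gaussianNormDensity n r := by
  have hA := sphereArea_pos hn
  rw [gaussianNormDensity, indicator_of_mem hr]
  have : 0 < r := hr
  positivity

lemma continuousOn_gaussianNormDensity (n : ℕ) :
    ContinuousOn (gaussianNormDensity n) (Ioi 0) := by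
  refine ContinuousOn.congr ?_ fun t ht => indicator_of_mem ht _
  fun_prop

end Gaussian

/-! ### Increasing transport and the construction of ρ -/

/-- Two probability densities, each continuous and positive on an open interval, are transported to
each other by a `C¹` diffeomorphism with positive derivative. -/
lemma exists_transport {U W : Set ℝ} {p q : ℝ → ℝ}
    (hU : IsOpen U) (hUc : U.OrdConnected) (hq : ContinuousOn q U) (hqpos : ∀ t ∈ U, 0 < q t)
    (hqzero : ∀ t ∉ U, q t = 0) (hqint : Integrable q) (hqone : ∫ t, q t = 1)
    (hW : IsOpen W) (hWc : W.OrdConnected) (hp : ContinuousOn p W) (hppos : ∀ t ∈ W, 0 < p t)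
    (hpzero : ∀ t ∉ W, p t = 0) (hpint : Integrable p) (hpone : ∫ t, p t = 1) :
    ∃ s : ℝ → ℝ, s '' W = U ∧ ∀ r ∈ W, HasDerivAt s (p r / q (s r)) r := by
  obtain ⟨F, hF, hFU⟩ := exists_distributionFunction hU hUc hq hqpos hqzero hqint hqone
  obtain ⟨G, hG, hGW⟩ := exists_distributionFunction hW hWc hp hppos hpzero hpint hpone
  have hinj := (strictMonoOn_of_hasDerivAt_pos hU hUc hF hqpos).injOn
  set ψ : ℝ → ℝ := Function.invFunOn F U with hψdef
  have hψ : ∀ t ∈ U, ψ (F t) = t := fun t ht => hinj.leftInvOn_invFunOn ht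
  refine ⟨ψ ∘ G, ?_, fun r hr => ?_⟩
  · rw [image_comp, hGW, ← hFU, image_image]
    exact (image_congr hψ).trans (image_id' U)
  · obtain ⟨t, ht, hFt⟩ : G r ∈ F '' U := by
      rw [hFU, ← hGW]
      exact mem_image_of_mem G hr
    have hst : (ψ ∘ G) r = t := by
      rw [Function.comp_apply, ← hFt, hψ t ht]
    have hd := hasDerivAt_leftInverse hU hUc hF hqpos hψ ht
    rw [hFt] at hd
    rw [hst, div_eq_inv_mul]
    exact hd.comp r (hG r hr)

/-- A `C¹` function on `(0, ∞)` with positive values and positive derivative is the restriction of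
`s_1^ρ` for some `ρ` satisfying (C). -/
lemma conditionC_div_self {s s' : ℝ → ℝ} (hs : ∀ r ∈ Ioi (0 : ℝ), 0 < s r)
    (hd : ∀ r ∈ Ioi (0 : ℝ), HasDerivAt s (s' r) r) (hs' : ∀ r ∈ Ioi (0 : ℝ), 0 < s' r)
    (hc : ContinuousOn s' (Ioi 0)) : ConditionC fun r => s r / r := by
  have hmap : ∀ r ∈ Ioi (0 : ℝ), radialMap (fun r => s r / r) r = s r := fun r hr => by
    rw [radialMap_of_pos _ hr, div_mul_cancel₀ _ (ne_of_gt hr)]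
  have hmono := strictMonoOn_of_hasDerivAt_pos isOpen_Ioi ordConnected_Ioi hd hs'
  have hsC : ContDiffOn ℝ 1 s (Ioi 0) := by
    rw [show (1 : WithTop ℕ∞) = 0 + 1 from (zero_add 1).symm,
      contDiffOn_succ_iff_deriv_of_isOpen isOpen_Ioi]
    refine ⟨fun r hr => (hd r hr).differentiableAt.differentiableWithinAt, by simp, ?_⟩
    rw [contDiffOn_zero]
    exact hc.congr fun r hr => (hd r hr).deriv
  have hzero : radialMap (fun r => s r / r) (0 : ℝ) = 0 := by simp [radialMap]
  have hmono0 : StrictMonoOn (radialMap (fun r => s r / r) : ℝ → ℝ) (Ici 0) := by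
    intro x hx y hy hxy
    have hy' : y ∈ Ioi (0 : ℝ) := lt_of_le_of_lt hx hxy
    rw [hmap y hy']
    rcases eq_or_lt_of_le (show (0 : ℝ) ≤ x from hx) with rfl | hx'
    · rw [hzero]
      exact hs y hy'
    · rw [hmap x hx']
      exact hmono hx' hy' hxy
  refine ⟨hsC.div contDiffOn_id fun r hr => ne_of_gt hr, fun r hr => div_pos (hs r hr) hr, ?_,
    fun r hr => ?_⟩
  · exact strictMono_of_odd_strictMonoOn_nonneg (fun x => radialMap_neg _ x) hmono0
  · have : radialMap (fun r => s r / r) =ᶠ[𝓝 r] s := by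
      filter_upwards [Ioi_mem_nhds hr] with x hx using hmap x hx
    rw [this.deriv_eq, (hd r hr).deriv]
    exact hs' r hr

/-! ### The two directions of the characterization -/

section Characterization

variable {n : ℕ} {f ρ : ℝ → ℝ}

/-- A connected subset of ℝ is convex, so its frontier is null. -/
lemma ae_eq_zero_of_notMem_interior_densitySupport
    (hc : IsPreconnected (densitySupport f)) :
    ∀ᵐ t ∂volume.restrict (Ioi (0 : ℝ)), t ∉ interior (densitySupport f) → f t = 0 := by
  have hfr : ∀ᵐ t ∂volume.restrict (Ioi (0 : ℝ)), t ∉ frontier (densitySupport f) :=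
    ae_restrict_of_ae (measure_eq_zero_iff_ae_notMem.1
      (hc.ordConnected.convex.addHaar_frontier volume))
  filter_upwards [ae_eq_zero_of_notMem_densitySupport f, hfr] with t h1 h2 h3
  refine h1 fun ht => h2 ?_
  rw [(isClosed_densitySupport f).frontier_eq]
  exact ⟨ht, h3⟩

lemma densitySupport_of_eq_limitMeasure (hn : 1 ≤ n) (hf : IsRadialDensity n f)
    (h : ConditionC ρ) (heq : radialMeasure n f = limitMeasure n ρ) :
    densitySupport f = closure ((radialMap ρ : ℝ → ℝ) '' Ioi 0) := by
  refine densitySupport_eq_closure (k := fun r => radialMass n f * limitProfile n ρ r)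
    h.isOpen_image ?_ (fun t ht => ?_) (fun t ht => ?_)
    ((radialMeasure_eq_limitMeasure_iff hn hf h).1 heq)
  · rintro _ ⟨r, hr, rfl⟩
    exact h.radialMap_pos hr
  · exact (mul_pos hf.mass_pos (limitProfile_pos h ht)).ne'
  · rw [limitProfile, indicator_of_notMem ht, mul_zero]

/-- An open interval is the interior of its closure. -/
lemma interior_densitySupport_of_eq_limitMeasure (hn : 1 ≤ n) (hf : IsRadialDensity n f)
    (h : ConditionC ρ) (heq : radialMeasure n f = limitMeasure n ρ) :
    interior (densitySupport f) = (radialMap ρ : ℝ → ℝ) '' Ioi 0 := by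
  have hV := h.isOpen_image
  have hne : (interior ((radialMap ρ : ℝ → ℝ) '' Ioi 0)).Nonempty := by
    rw [hV.interior_eq]
    exact nonempty_Ioi.image _
  rw [densitySupport_of_eq_limitMeasure hn hf h heq,
    (h.ordConnected_image.convex (𝕜 := ℝ)).interior_closure_eq_interior_of_nonempty_interior hne,
    hV.interior_eq]

lemma IsGeneralizedPoincareLimit.isConnected_and_version (hn : 1 ≤ n) (hf : IsRadialDensity n f)
    (h : IsGeneralizedPoincareLimit n f) :
    IsConnected (densitySupport f) ∧
      HasContinuousPosVersionOn f (interior (densitySupport f)) := by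
  obtain ⟨ρ, hρ, heq⟩ := h
  refine ⟨?_, fun r => radialMass n f * limitProfile n ρ r, ?_, fun r hr => ?_, ?_⟩
  · rw [densitySupport_of_eq_limitMeasure hn hf hρ heq]
    exact IsConnected.closure
      ⟨nonempty_Ioi.image _, hρ.ordConnected_image.isPreconnected⟩
  · rw [interior_densitySupport_of_eq_limitMeasure hn hf hρ heq]
    exact continuousOn_const.mul (continuousOn_limitProfile hρ)
  · rw [interior_densitySupport_of_eq_limitMeasure hn hf hρ heq] at hr
    exact mul_pos hf.mass_pos (limitProfile_pos hρ hr)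
  · refine ae_restrict_of_ae_restrict_of_subset ?_
      ((radialMeasure_eq_limitMeasure_iff hn hf hρ).1 heq)
    rw [← interior_Ici]
    exact interior_mono (densitySupport_subset_Ici f)

lemma isGeneralizedPoincareLimit_of_version (hn : 1 ≤ n) (hf : IsRadialDensity n f)
    (hconn : IsConnected (densitySupport f))
    (hver : HasContinuousPosVersionOn f (interior (densitySupport f))) :
    IsGeneralizedPoincareLimit n f := by
  obtain ⟨g, hgc, hgpos, hfg⟩ := hver
  set U := interior (densitySupport f) with hUdef
  set M := radialMass n f with hM
  have hMpos : 0 < M := hf.mass_pos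
  have hA := sphereArea_pos hn
  have hU : IsOpen U := isOpen_interior
  have hUc : U.OrdConnected := hconn.isPreconnected.ordConnected.convex.interior.ordConnected
  have hU0 : U ⊆ Ioi 0 := by
    rw [← interior_Ici]
    exact interior_mono (densitySupport_subset_Ici f)
  have hfg0 : f =ᵐ[volume.restrict (Ioi (0 : ℝ))] U.indicator g := by
    have hfg' := ae_restrict_of_ae (s := Ioi (0 : ℝ)) ((ae_restrict_iff' hU.measurableSet).1 hfg)
    filter_upwards [hfg', ae_eq_zero_of_notMem_interior_densitySupport hconn.isPreconnected]
      with t h1 h2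
    by_cases ht : t ∈ U
    · rw [indicator_of_mem ht, h1 ht]
    · rw [indicator_of_notMem ht, h2 ht]
  -- The density of |x| under μ_n^f, in the version continuous on U; A_n r^(n-1) is the polar
  -- factor.
  set q : ℝ → ℝ := U.indicator fun r => sphereArea n / M * (g r * r ^ (n - 1)) with hq
  have hqmem : ∀ t ∈ U, q t = sphereArea n / M * (g t * t ^ (n - 1)) := fun t ht =>
    indicator_of_mem ht _
  have hqzero : ∀ t ∉ U, q t = 0 := fun t ht => indicator_of_notMem ht _
  have hqpos : ∀ t ∈ U, 0 < q t := fun t ht => by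
    rw [hqmem t ht]
    exact mul_pos (div_pos hA hMpos) (mul_pos (hgpos t ht) (pow_pos (hU0 ht) _))
  have hqcont : ContinuousOn q U :=
    (continuousOn_const.mul (hgc.mul (continuousOn_id.pow _))).congr hqmem
  have hqae : q =ᵐ[volume] (Ioi (0 : ℝ)).indicator fun r =>
      sphereArea n / M * (f r * r ^ (n - 1)) := by
    filter_upwards [(ae_restrict_iff' measurableSet_Ioi).1 hfg0] with t ht
    by_cases ht0 : t ∈ Ioi (0 : ℝ)
    · rw [indicator_of_mem ht0, ht ht0]
      by_cases htU : t ∈ U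
      · rw [hqmem t htU, indicator_of_mem htU]
      · rw [hqzero t htU, indicator_of_notMem htU, zero_mul, mul_zero]
    · rw [indicator_of_notMem ht0, hqzero t fun h => ht0 (hU0 h)]
  have hqint : Integrable q := by
    refine Integrable.congr ?_ hqae.symm
    exact (integrable_indicator_iff measurableSet_Ioi).2 (hf.integrableOn.const_mul _)
  have hqone : ∫ t, q t = 1 := by
    rw [integral_congr_ae hqae, integral_indicator measurableSet_Ioi, integral_const_mul,
      div_mul_eq_mul_div]
    exact div_self hMpos.ne'
  obtain ⟨s, hsU, hsd⟩ := exists_transport hU hUc hqcont hqpos hqzero hqint hqone isOpen_Ioi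
    ordConnected_Ioi (continuousOn_gaussianNormDensity n)
    (fun t ht => gaussianNormDensity_pos hn ht) (fun t ht => indicator_of_notMem ht _)
    -- A non-integrable function has integral 0 by convention, so integral 1 forces integrability.
    (Integrable.of_integral_ne_zero (by simp [integral_gaussianNormDensity hn]))
    (integral_gaussianNormDensity hn)
  have hsmem : ∀ r ∈ Ioi (0 : ℝ), s r ∈ U := fun r hr => hsU ▸ mem_image_of_mem s hr
  have hscont : ContinuousOn s (Ioi 0) := fun r hr => (hsd r hr).continuousAt.continuousWithinAt
  have hC : ConditionC fun r => s r / r :=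
    conditionC_div_self (fun r hr => hU0 (hsmem r hr)) hsd
      (fun r hr => div_pos (gaussianNormDensity_pos hn hr) (hqpos _ (hsmem r hr)))
      ((continuousOn_gaussianNormDensity n).div (hqcont.comp hscont hsmem)
        fun r hr => (hqpos _ (hsmem r hr)).ne')
  have hmap : ∀ r ∈ Ioi (0 : ℝ), radialMap (fun r => s r / r) r = s r := fun r hr => by
    rw [radialMap_of_pos _ hr, div_mul_cancel₀ _ (ne_of_gt hr)]
  have himg : (radialMap (fun r => s r / r) : ℝ → ℝ) '' Ioi 0 = U := by
    rw [← hsU]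
    exact image_congr hmap
  refine ⟨fun r => s r / r, hC, (radialMeasure_eq_limitMeasure_iff hn hf hC).2 ?_⟩
  filter_upwards [hfg0] with t ht
  rw [ht]
  by_cases htU : t ∈ U
  · rw [indicator_of_mem htU]
    rw [← himg] at htU
    obtain ⟨r, hr, rfl⟩ := htU
    have hr0 : 0 < r := hr
    have hderiv : deriv (radialMap fun r => s r / r) r = gaussianNormDensity n r / q (s r) := by
      have : radialMap (fun r => s r / r) =ᶠ[𝓝 r] s := by
        filter_upwards [Ioi_mem_nhds hr0] with x hx using hmap x hx
      rw [this.deriv_eq, (hsd r hr).deriv]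
    have hs0 : 0 < s r := hU0 (hsmem r hr)
    rw [limitProfile_radialMap hC hr0, hderiv, hmap r hr, hqmem _ (hsmem r hr),
      gaussianNormDensity, indicator_of_mem hr, ← hM, div_pow]
    have hπ : (2 * Real.pi) ^ (-(n : ℝ) / 2) ≠ 0 := by positivity
    -- After substituting s' = p / (q ∘ s), the Gaussian factor, A_n, M and the powers of r and s(r)
    -- cancel, leaving g(s(r)).
    field_simp
  · rw [indicator_of_notMem htU, limitProfile, himg, indicator_of_notMem htU, mul_zero]

end Characterization

end GenPoincare

end

theorem proposition2p2 (n : ℕ) (hn : 1 ≤ n) (f : ℝ → ℝ)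
    (hf : GenPoincare.IsRadialDensity n f) :
    (GenPoincare.IsGeneralizedPoincareLimit n f ↔
      IsConnected (GenPoincare.densitySupport f) ∧
        GenPoincare.HasContinuousPosVersionOn f (interior (GenPoincare.densitySupport f))) ∧
    (∀ ρ : ℝ → ℝ, GenPoincare.ConditionC ρ →
      GenPoincare.radialMeasure n f = GenPoincare.limitMeasure n ρ →
        GenPoincare.densitySupport f =
          closure ((GenPoincare.radialMap ρ : ℝ → ℝ) '' Set.Ioi 0)) :=
  ⟨⟨fun h => h.isConnected_and_version hn hf,
    fun h => GenPoincare.isGeneralizedPoincareLimit_of_version hn hf h.1 h.2⟩,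
    fun _ hρ heq => GenPoincare.densitySupport_of_eq_limitMeasure hn hf hρ heq⟩
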